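/- All graphs are finite, simple and have at least one vertex. A graph $G$ is $k$-critical if $\chi(G)=k$ and $\chi(G')<k$ for every proper subgraph $G'$ of $G$; it is critical if it is $k$-critical for some $k$. The join $G\vee K_t$ ($t\ge 0$) is obtained from $G$ by adding $t$ new vertices that are adjacent to each other and to all vertices of $G$. A cover (DP-cover, or correspondence cover) of a graph $G$ is a pair $\mathcal H=(L,H)$, where $H$ is a graph (possibly with no vertices), whose vertices are called colors, and $L$ assigns to each $v\in V(G)$ a set $L(v)\subseteq V(H)$ such that the sets $L(v)$ are pairwise disjoint, independent in $H$, and have union $V(H)$, and such that whenever $H$ has an edge between $L(u)$ and $L(v)$, we have $uv\in E(G)$ and the set of edges of $H$ between $L(u)$ and $L(v)$ is a (not necessarily perfect) matching. The cover is $k$-fold if $|L(v)|=k$ for all $v\in V(G)$, where $k = 0$ is allowed. It is bad if $H$ has no independent set that contains exactly one element of each $L(v)$. A $k$-fold cover is canonical if there is a map $\lambda\colon V(H)\to\{1,\dots,k\}$ that restricts to a bijection $L(v)\to\{1,\dots,k\}$ for each $v\in V(G)$ and such that for all $uv\in E(G)$, $c\in L(u)$ and $c'\in L(v)$, we have $cc'\in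 E(H)$ if and only if $\lambda(c)=\lambda(c')$. A graph is robustly critical if, for some $k\ge 1$, it is $k$-critical and each of its bad $(k-1)$-fold covers is canonical. **Theorem.** If $G$ is a critical graph with $m$ edges, then for every integer $t\ge 100m^3$, the graph $G\vee K_t$ is robustly critical. -/

import Mathlib

universe u v w

namespace DPColoring

/-- The join of two graphs: disjoint copies of `G` and `H`, with every vertex of the copy of `G`
adjacent to every vertex of the copy of `H`. -/
def join {V : Type u} {W : Type v} (G : SimpleGraph V) (H : SimpleGraph W) :
    SimpleGraph (V ⊕ W) :=
  SimpleGraph.sum G H ⊔ completeBipartiteGraph V W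

/-- `G` is `k`-critical: `χ(G) = k` and `χ(G') < k` for every proper subgraph `G'` of `G`. -/
def IsKCritical {V : Type u} (G : SimpleGraph V) (k : ℕ) : Prop :=
  G.chromaticNumber = k ∧
    ∀ G' : G.Subgraph, G' ≠ ⊤ → G'.coe.chromaticNumber < k

/-- `G` is critical if it is `k`-critical for some `k`. -/
def IsCritical {V : Type u} (G : SimpleGraph V) : Prop :=
  ∃ k : ℕ, IsKCritical G k

/-- A cover (DP-cover, correspondence cover) `(L, H)` of the graph `G`; the vertices of `H`,
called colors, are the elements of the type `C`. -/
structure Cover {V : Type u} (G : SimpleGraph V) (C : Type w) where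
  /-- The graph on the colors. -/
  H : SimpleGraph C
  /-- The list of colors of each vertex. -/
  L : V → Set C
  disjoint : Pairwise fun x y => Disjoint (L x) (L y)
  indep : ∀ x, H.IsIndepSet (L x)
  covers : ⋃ x, L x = Set.univ
  /-- If there is an edge of `H` between two lists, then their vertices are adjacent. -/
  adj_of_adj : ∀ x y, ∀ c ∈ L x, ∀ c' ∈ L y, H.Adj c c' → G.Adj x y
  /-- The edges of `H` between two lists form a matching (the roles of `x` and `y` may be
  exchanged, so each color of either list is in at most one of these edges). -/
  matching : ∀ x y, ∀ c ∈ L x, ∀ c₁ ∈ L y, ∀ c₂ ∈ L y, H.Adj c c₁ → H.Adj c c₂ → c₁ = c₂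

namespace Cover

variable {V : Type u} {G : SimpleGraph V} {C : Type w}

/-- An independent set of `H` that contains exactly one color from each list. -/
def IsIndepTransversal (𝓗 : Cover G C) (T : Set C) : Prop :=
  𝓗.H.IsIndepSet T ∧ ∀ x, ∃! c, c ∈ T ∩ 𝓗.L x

/-- The cover is bad: `G` has no proper coloring with respect to it. -/
def IsBad (𝓗 : Cover G C) : Prop :=
  ¬ ∃ T : Set C, 𝓗.IsIndepTransversal T

/-- All lists have exactly `k` elements. -/
def IsFold (𝓗 : Cover G C) (k : ℕ) : Prop :=
  ∀ x, (𝓗.L x).encard = k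

/-- A canonical labeling with `k` labels. -/
def IsCanonicalLabeling (𝓗 : Cover G C) {k : ℕ} (lab : C → Fin k) : Prop :=
  (∀ x, Set.BijOn lab (𝓗.L x) Set.univ) ∧
    ∀ x y, G.Adj x y → ∀ c ∈ 𝓗.L x, ∀ c' ∈ 𝓗.L y, (𝓗.H.Adj c c' ↔ lab c = lab c')

/-- The cover is a canonical `k`-fold cover. -/
def IsCanonical (𝓗 : Cover G C) (k : ℕ) : Prop :=
  𝓗.IsFold k ∧ ∃ lab : C → Fin k, 𝓗.IsCanonicalLabeling lab

end Cover

/-- `G` is robustly `k`-critical: it is `k`-critical (where `k ≥ 1`) and each of its bad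
`(k - 1)`-fold covers is canonical. The colors range over an arbitrary universe `w`. -/
def IsRobustlyKCritical {V : Type u} (G : SimpleGraph V) (k : ℕ) : Prop :=
  1 ≤ k ∧ IsKCritical G k ∧
    ∀ (C : Type w) (𝓗 : Cover G C), 𝓗.IsFold (k - 1) → 𝓗.IsBad → 𝓗.IsCanonical (k - 1)

/-- `G` is robustly critical if it is robustly `k`-critical for some `k`. -/
def IsRobustlyCritical {V : Type u} (G : SimpleGraph V) : Prop :=
  ∃ k : ℕ, IsRobustlyKCritical.{u, w} G k

end DPColoring

/-! Let `G` be `(r + 1)`-critical and take an `(r + t)`-fold cover of the join. Coloring a clique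
vertex greedily takes at most one color from every other list while one clique vertex disappears, so
the surplus of every list over the clique never falls below `r`. It grows at a vertex `v` of `G`
whose list loses nothing, or which loses a single color to two clique vertices.

The engine is `hasColoring_of_gain`: one unit of surplus at one vertex of `G` already yields a
coloring if the clique is large. Call `v` short if its list is too small to be colored last. Either
a greedy step on one or two clique vertices reduces the total shortfall, or the cover looks
canonical between the clique and the short vertices: the colors of one clique vertex `a₀` serve as
labels for both. In the latter case the classes of a coloring of `G` receive labels. A whole class
then costs each clique vertex only one color (`hasColoring_of_labels`), and criticality supplies
colorings with few enough classes. The cover need not respect labels along the edges of `G`, but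
each edge rules out few labels, so labels can be chosen to avoid all conflicts (`exists_labels`).

Consequently a bad cover admits no gain, which forces every color to have a label and labels to be
consistent with the clique. An edge `uv` of `G` that violates the labels also gives a coloring: `G`
minus `uv` has an `r`-coloring with `u` and `v` in one class, and that class takes the violated
label (`hasColoring_of_twisted_edge`). Hence all edges respect the labels and the cover is
canonical. -/

namespace DPColoring

/-! ### Matched lists and greedy colorings -/

section Core

open Finset

open scoped Classical

/-- Each color of `X` has at most one neighbor in `Y`. -/
def Matched {C : Type w} (H : SimpleGraph C) (X Y : Finset C) : Prop :=
  ∀ c ∈ X, ∀ c₁ ∈ Y, ∀ c₂ ∈ Y, H.Adj c c₁ → H.Adj c c₂ → c₁ = c₂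

theorem Matched.mono {C : Type w} {H : SimpleGraph C} {X X' Y Y' : Finset C}
    (h : Matched H X Y) (hX : X' ⊆ X) (hY : Y' ⊆ Y) : Matched H X' Y' :=
  fun c hc c₁ h₁ c₂ h₂ => h c (hX hc) c₁ (hY h₁) c₂ (hY h₂)

/-- The colors of `X` that are not adjacent to `c`. -/
noncomputable def avoid {C : Type w} (H : SimpleGraph C) (c : C) (X : Finset C) : Finset C :=
  X.filter fun c' => ¬ H.Adj c c'

theorem mem_avoid {C : Type w} {H : SimpleGraph C} {c c' : C} {X : Finset C} :
    c' ∈ avoid H c X ↔ c' ∈ X ∧ ¬ H.Adj c c' := by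
  simp [avoid]

theorem avoid_subset {C : Type w} (H : SimpleGraph C) (c : C) (X : Finset C) :
    avoid H c X ⊆ X :=
  filter_subset _ _

theorem avoid_eq_self {C : Type w} {H : SimpleGraph C} {c : C} {X : Finset C}
    (h : ∀ c' ∈ X, ¬ H.Adj c c') : avoid H c X = X :=
  filter_true_of_mem h

theorem Matched.card_le_card_avoid_add_one {C : Type w} {H : SimpleGraph C} {X Y : Finset C}
    (h : Matched H X Y) {c : C} (hc : c ∈ X) : #Y ≤ #(avoid H c Y) + 1 := by
  have h1 : #(Y.filter fun c' => H.Adj c c') ≤ 1 := by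
    rw [card_le_one]
    intro x hx y hy
    rw [mem_filter] at hx hy
    exact h c hc x hx.1 y hy.1 hx.2 hy.2
  have h2 := card_filter_add_card_filter_not (s := Y) (fun c' => H.Adj c c')
  unfold avoid
  omega

/-- If each constraint excludes at most one element of `X` and there are fewer constraints than
elements, then some element satisfies all of them. -/
theorem exists_mem_forall_not {ι : Type*} {C : Type w} (s : Finset ι) (X : Finset C)
    (R : ι → C → Prop)
    (hR : ∀ i ∈ s, ∀ c₁ ∈ X, ∀ c₂ ∈ X, R i c₁ → R i c₂ → c₁ = c₂) (hs : #s < #X) :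
    ∃ c ∈ X, ∀ i ∈ s, ¬ R i c := by
  by_contra! hcon
  obtain ⟨c₀, hc₀⟩ := card_pos.1 (Nat.zero_lt_of_lt hs)
  have : Nonempty ι := ⟨(hcon c₀ hc₀).choose⟩
  choose! i hi hiR using hcon
  refine absurd (card_le_card_of_injOn i hi ?_) (not_le.2 hs)
  intro c₁ h₁ c₂ h₂ h
  refine hR (i c₁) (hi c₁ h₁) c₁ h₁ c₂ h₂ (hiR c₁ h₁) ?_
  rw [h]
  exact hiR c₂ h₂

variable {V : Type u} {A : Type v} {C : Type w} {G : SimpleGraph V} {H : SimpleGraph C}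
  {L : V → Finset C} {M : A → Finset C} {B : Finset A} {r : ℕ}

/-- The edges of `H` between any two of the lists `L v` and `M a` form a matching. -/
structure IsMatchedPair (H : SimpleGraph C) (L : V → Finset C) (M : A → Finset C) : Prop where
  LL : ∀ u v, Matched H (L u) (L v)
  LM : ∀ v a, Matched H (L v) (M a)
  ML : ∀ a v, Matched H (M a) (L v)
  MM : ∀ a b, Matched H (M a) (M b)

theorem IsMatchedPair.mono {L' : V → Finset C} {M' : A → Finset C} (h : IsMatchedPair H L M)
    (hL : ∀ v, L' v ⊆ L v) (hM : ∀ a, M' a ⊆ M a) : IsMatchedPair H L' M' where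
  LL u v := (h.LL u v).mono (hL u) (hL v)
  LM v a := (h.LM v a).mono (hL v) (hM a)
  ML a v := (h.ML a v).mono (hM a) (hL v)
  MM a b := (h.MM a b).mono (hM a) (hM b)

/-- A coloring from the lists `L` and `M` of the join of `G` and the complete graph on `B`. -/
def HasColoring (G : SimpleGraph V) (H : SimpleGraph C) (L : V → Finset C) (M : A → Finset C)
    (B : Finset A) : Prop :=
  ∃ (f : V → C) (g : A → C), (∀ v, f v ∈ L v) ∧ (∀ a ∈ B, g a ∈ M a) ∧
    (∀ u v, G.Adj u v → ¬ H.Adj (f u) (f v)) ∧ (∀ a ∈ B, ∀ v, ¬ H.Adj (g a) (f v)) ∧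
    ∀ a ∈ B, ∀ b ∈ B, a ≠ b → ¬ H.Adj (g a) (g b)

/-- Coloring the vertex `a` with `c` and removing the neighbors of `c` from all lists. -/
theorem HasColoring.of_avoid {a : A} {c : C} (hc : c ∈ M a)
    (h : HasColoring G H (fun v => avoid H c (L v)) (fun b => avoid H c (M b)) (B.erase a)) :
    HasColoring G H L M B := by
  obtain ⟨f, g, hf, hg, hff, hgf, hgg⟩ := h
  simp only [mem_avoid] at hf hg
  refine ⟨f, Function.update g a c, fun v => (hf v).1, ?_, hff, ?_, ?_⟩
  · intro b hb
    by_cases hab : b = a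
    · subst hab; simpa using hc
    · simpa [hab] using (hg b (mem_erase.2 ⟨hab, hb⟩)).1
  · intro b hb v
    by_cases hab : b = a
    · subst hab; simpa using (hf v).2
    · simpa [hab] using hgf b (mem_erase.2 ⟨hab, hb⟩) v
  · intro b hb b' hb' hne
    by_cases hab : b = a
    · subst hab
      simpa [hne.symm] using (hg b' (mem_erase.2 ⟨hne.symm, hb'⟩)).2
    · by_cases hab' : b' = a
      · subst hab'
        simpa [hab, H.adj_comm] using (hg b (mem_erase.2 ⟨hab, hb⟩)).2
      · simpa [hab, hab'] using hgg b (mem_erase.2 ⟨hab, hb⟩) b' (mem_erase.2 ⟨hab', hb'⟩) hne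

/-- The lists form matchings and exceed the number of vertices of `B` by at least `r`. -/
structure IsAmple (H : SimpleGraph C) (L : V → Finset C) (M : A → Finset C) (B : Finset A)
    (r : ℕ) : Prop where
  matched : IsMatchedPair H L M
  card_M : ∀ a ∈ B, #B + r ≤ #(M a)
  card_L : ∀ v, #B + r ≤ #(L v)

/-- The color `c` has at most one neighbor in each list, and `B` also loses a vertex, so the surplus
`r` survives. -/
theorem IsAmple.avoid (h : IsAmple H L M B r) {a : A} (ha : a ∈ B) {c : C} (hc : c ∈ M a) :
    IsAmple H (fun v => avoid H c (L v)) (fun b => avoid H c (M b)) (B.erase a) r where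
  matched := h.matched.mono (fun _ => avoid_subset _ _ _) (fun _ => avoid_subset _ _ _)
  card_M b hb := by
    have h1 := (h.matched.MM a b).card_le_card_avoid_add_one hc
    have h2 := h.card_M b (mem_of_mem_erase hb)
    have h3 := card_erase_add_one ha
    omega
  card_L v := by
    have h1 := (h.matched.ML a v).card_le_card_avoid_add_one hc
    have h2 := h.card_L v
    have h3 := card_erase_add_one ha
    omega

/-- Greedy coloring of a complete graph. -/
theorem exists_coloring_clique [Nonempty C] (hM : ∀ a b, Matched H (M a) (M b)) (B : Finset A)
    (hB : ∀ a ∈ B, #B ≤ #(M a)) :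
    ∃ g : A → C, (∀ a ∈ B, g a ∈ M a) ∧ ∀ a ∈ B, ∀ b ∈ B, a ≠ b → ¬ H.Adj (g a) (g b) := by
  induction B using Finset.induction_on with
  | empty => exact ⟨fun _ => Classical.arbitrary C, by simp, by simp⟩
  | insert a B ha ih =>
    rw [card_insert_of_notMem ha] at hB
    obtain ⟨g, hg, hgg⟩ := ih fun b hb => (Nat.le_succ _).trans (hB b (mem_insert_of_mem hb))
    obtain ⟨c, hc, hcg⟩ := exists_mem_forall_not B (M a) (fun b c => H.Adj (g b) c)
      (fun b hb c₁ h₁ c₂ h₂ => hM b a (g b) (hg b hb) c₁ h₁ c₂ h₂)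
      (hB a (mem_insert_self a B))
    have hne : ∀ b ∈ B, b ≠ a := fun b hb h => ha (h ▸ hb)
    refine ⟨Function.update g a c, ?_, ?_⟩
    · intro b hb
      rcases mem_insert.1 hb with rfl | hb
      · simpa using hc
      · simpa [hne b hb] using hg b hb
    · intro b hb b' hb' hbb
      rcases mem_insert.1 hb with rfl | h <;> rcases mem_insert.1 hb' with rfl | h'
      · exact absurd rfl hbb
      · simpa [hne b' h', H.adj_comm] using hcg b' h'
      · simpa [hne b h] using hcg b h
      · simpa [hne b h, hne b' h'] using hgg b h b' h' hbb

/-- Greedy coloring of a complete graph in which one vertex `a₀` is colored last. -/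
theorem exists_coloring_clique_of_last [Nonempty C] (hM : ∀ a b, Matched H (M a) (M b))
    {a₀ : A} (ha₀ : a₀ ∈ B) (hB : ∀ a ∈ B, #B ≤ #(M a) + 1) (h₀ : #B ≤ #(M a₀)) :
    ∃ g : A → C, (∀ a ∈ B, g a ∈ M a) ∧ ∀ a ∈ B, ∀ b ∈ B, a ≠ b → ¬ H.Adj (g a) (g b) := by
  have hcard := card_erase_add_one ha₀
  obtain ⟨g, hg, hgg⟩ := exists_coloring_clique hM (B.erase a₀) fun a ha => by
    have := hB a (mem_of_mem_erase ha)
    omega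
  obtain ⟨c, hc, hcg⟩ := exists_mem_forall_not (B.erase a₀) (M a₀) (fun b c => H.Adj (g b) c)
    (fun b hb c₁ h₁ c₂ h₂ => hM b a₀ (g b) (hg b hb) c₁ h₁ c₂ h₂) (by omega)
  refine ⟨Function.update g a₀ c, ?_, ?_⟩
  · intro b hb
    by_cases h : b = a₀
    · subst h; simpa using hc
    · simpa [h] using hg b (mem_erase.2 ⟨h, hb⟩)
  · intro b hb b' hb' hbb
    by_cases h : b = a₀
    · subst h
      simpa [hbb.symm, H.adj_comm] using hcg b' (mem_erase.2 ⟨hbb.symm, hb'⟩)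
    · by_cases h' : b' = a₀
      · subst h'
        simpa [h] using hcg b (mem_erase.2 ⟨h, hb⟩)
      · simpa [h, h'] using hgg b (mem_erase.2 ⟨h, hb⟩) b' (mem_erase.2 ⟨h', hb'⟩) hbb

variable [Fintype V]

/-- Extending a coloring of `U` and `B` greedily to the vertices with long lists. -/
theorem hasColoring_of_extend (h : IsMatchedPair H L M) (U : Finset V) (f : V → C) (g : A → C)
    (hf : ∀ v ∈ U, f v ∈ L v) (hg : ∀ a ∈ B, g a ∈ M a)
    (hff : ∀ u ∈ U, ∀ v ∈ U, G.Adj u v → ¬ H.Adj (f u) (f v))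
    (hgf : ∀ a ∈ B, ∀ v ∈ U, ¬ H.Adj (g a) (f v))
    (hgg : ∀ a ∈ B, ∀ b ∈ B, a ≠ b → ¬ H.Adj (g a) (g b))
    (hS : ∀ v, v ∉ U → #B + G.degree v + 1 ≤ #(L v)) : HasColoring G H L M B := by
  suffices hT : ∀ T : Finset V, (∀ v ∈ T, v ∉ U) → ∃ f : V → C, (∀ v ∈ U ∪ T, f v ∈ L v) ∧
      (∀ u ∈ U ∪ T, ∀ v ∈ U ∪ T, G.Adj u v → ¬ H.Adj (f u) (f v)) ∧
      (∀ a ∈ B, ∀ v ∈ U ∪ T, ¬ H.Adj (g a) (f v)) by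
    obtain ⟨f, h1, h2, h3⟩ := hT Uᶜ (by simp)
    rw [union_compl] at h1 h2 h3
    exact ⟨f, g, fun v => h1 v (mem_univ v), hg, fun u v => h2 u (mem_univ u) v (mem_univ v),
      fun a ha v => h3 a ha v (mem_univ v), hgg⟩
  intro T
  induction T using Finset.induction_on with
  | empty => intro _; exact ⟨f, by simpa using hf, by simpa using hff, by simpa using hgf⟩
  | insert x T hx ih =>
    intro hTU
    obtain ⟨f, h1, h2, h3⟩ := ih fun v hv => hTU v (mem_insert_of_mem hv)
    have hxU : x ∉ U := hTU x (mem_insert_self x T)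
    have hxW : x ∉ U ∪ T := by simp [hx, hxU]
    obtain ⟨c, hc, hcB⟩ := exists_mem_forall_not (B.disjSum (G.neighborFinset x ∩ (U ∪ T))) (L x)
      (fun i c => H.Adj (Sum.elim g f i) c)
      (by
        rintro (a | v) hi c₁ h₁ c₂ h₂
        · exact h.ML a x (g a) (hg a (by simpa using hi)) c₁ h₁ c₂ h₂
        · rw [inr_mem_disjSum, mem_inter] at hi
          exact h.LL v x (f v) (h1 v hi.2) c₁ h₁ c₂ h₂)
      (by
        have h4 : #(G.neighborFinset x ∩ (U ∪ T)) ≤ G.degree x := card_le_card inter_subset_left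
        have h5 := hS x hxU
        rw [card_disjSum]
        omega)
    have hcg : ∀ a ∈ B, ¬ H.Adj (g a) c := fun a ha => hcB (Sum.inl a) (by simpa using ha)
    have hcf : ∀ v ∈ U ∪ T, G.Adj x v → ¬ H.Adj (f v) c := fun v hv hxv =>
      hcB (Sum.inr v) (by
        rw [inr_mem_disjSum, mem_inter, SimpleGraph.mem_neighborFinset]
        exact ⟨hxv, hv⟩)
    have hne : ∀ v ∈ U ∪ T, v ≠ x := fun v hv e => hxW (e ▸ hv)
    rw [union_insert]
    refine ⟨Function.update f x c, ?_, ?_, ?_⟩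
    · intro v hv
      rcases mem_insert.1 hv with rfl | hv
      · simpa using hc
      · simpa [hne v hv] using h1 v hv
    · intro u hu v hv huv
      rcases mem_insert.1 hu with rfl | hu' <;> rcases mem_insert.1 hv with rfl | hv'
      · exact absurd huv (G.irrefl)
      · simpa [hne v hv', H.adj_comm] using hcf v hv' huv
      · simpa [hne u hu'] using hcf u hu' huv.symm
      · simpa [hne u hu', hne v hv'] using h2 u hu' v hv' huv
    · intro a ha v hv
      rcases mem_insert.1 hv with rfl | hv
      · simpa using hcg a ha
      · simpa [hne v hv] using h3 a ha v hv

/-! ### Colorings by labels -/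

/-- Choice of a color of `X` for each class of `κ` such that the coloring of `U` obtained by
transporting these colors along `φ` is compatible with the coloring `f₀` of `U₀`. -/
theorem exists_labels (hL : ∀ u v, Matched H (L u) (L v)) (X : Finset C) (φ : V → C → C)
    (U U₀ : Finset V) (hdisj : ∀ u ∈ U, u ∉ U₀) (κ : V → ℕ)
    (hφ : ∀ u ∈ U, ∀ c ∈ X, φ u c ∈ L u)
    (hinj : ∀ u ∈ U, ∀ c₁ ∈ X, ∀ c₂ ∈ X, φ u c₁ = φ u c₂ → c₁ = c₂)
    (hκ : ∀ u ∈ U, ∀ v ∈ U, G.Adj u v → κ u ≠ κ v) (f₀ : V → C) (hf₀ : ∀ u ∈ U₀, f₀ u ∈ L u)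
    (hff₀ : ∀ u ∈ U₀, ∀ v ∈ U₀, G.Adj u v → ¬ H.Adj (f₀ u) (f₀ v))
    (hX : ∑ v, G.degree v < #X) :
    ∃ l : ℕ → C, (∀ p, l p ∈ X) ∧ ∀ u ∈ U₀ ∪ U, ∀ v ∈ U₀ ∪ U, G.Adj u v →
      ¬ H.Adj (if u ∈ U₀ then f₀ u else φ u (l (κ u))) (if v ∈ U₀ then f₀ v else φ v (l (κ v))) := by
  suffices hn : ∀ n : ℕ, ∃ l : ℕ → C, (∀ p, l p ∈ X) ∧
      ∀ u ∈ U₀ ∪ U.filter (fun x => κ x < n), ∀ v ∈ U₀ ∪ U.filter (fun x => κ x < n), G.Adj u v →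
      ¬ H.Adj (if u ∈ U₀ then f₀ u else φ u (l (κ u)))
        (if v ∈ U₀ then f₀ v else φ v (l (κ v))) by
    have hU : U.filter (fun x => κ x < univ.sup κ + 1) = U :=
      filter_true_of_mem fun x _ => Nat.lt_succ_of_le (le_sup (f := κ) (mem_univ x))
    have := hn (univ.sup κ + 1)
    rwa [hU] at this
  intro n
  induction n with
  | zero =>
    obtain ⟨c, hc⟩ := card_pos.1 (Nat.zero_lt_of_lt hX)
    refine ⟨fun _ => c, fun _ => hc, ?_⟩
    intro u hu v hv huv
    simp only [Nat.not_lt_zero, filter_false, union_empty] at hu hv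
    simpa [hu, hv] using hff₀ u hu v hv huv
  | succ n ih =>
    obtain ⟨l, hlX, hl⟩ := ih
    set W := U₀ ∪ U.filter (fun x => κ x < n) with hW
    set f : V → C := fun u => if u ∈ U₀ then f₀ u else φ u (l (κ u)) with hf
    have hfL : ∀ u ∈ W, f u ∈ L u := by
      intro u hu
      by_cases h0 : u ∈ U₀
      · simpa [hf, h0] using hf₀ u h0
      · have hu' : u ∈ U := by
          rw [hW, mem_union, mem_filter] at hu
          tauto
        simpa [hf, h0] using hφ u hu' _ (hlX _)
    -- The constraints are indexed by ordered pairs of adjacent vertices, whence the bound by the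
    -- degree sum. Each excludes at most one label, since `H` is matched and `φ y` is injective.
    obtain ⟨c, hc, hcR⟩ := exists_mem_forall_not
      ((univ : Finset V).sigma fun v => G.neighborFinset v) X
      (fun i c => i.1 ∈ W ∧ i.2 ∈ U ∧ H.Adj (f i.1) (φ i.2 c))
      (by
        rintro ⟨x, y⟩ - c₁ h₁ c₂ h₂ ⟨hx, hy, e₁⟩ ⟨-, -, e₂⟩
        exact hinj y hy c₁ h₁ c₂ h₂ (hL x y (f x) (hfL x hx) _ (hφ y hy c₁ h₁) _
          (hφ y hy c₂ h₂) e₁ e₂))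
      (by simpa [card_sigma] using hX)
    have hc' : ∀ x ∈ W, ∀ y ∈ U, G.Adj x y → ¬ H.Adj (f x) (φ y c) := fun x hx y hy hxy hh =>
      hcR ⟨x, y⟩ (by simpa using hxy) ⟨hx, hy, hh⟩
    refine ⟨Function.update l n c, ?_, ?_⟩
    · intro p
      by_cases hp : p = n
      · subst hp; simpa using hc
      · simpa [hp] using hlX p
    have hold : ∀ u ∈ W,
        (if u ∈ U₀ then f₀ u else φ u (Function.update l n c (κ u))) = f u := by
      intro u hu
      by_cases h0 : u ∈ U₀
      · simp [hf, h0]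
      · have hu' : κ u ≠ n := by
          rw [hW, mem_union, mem_filter] at hu
          rcases hu with hu | hu
          · exact absurd hu h0
          · exact hu.2.ne
        simp [hf, h0, hu']
    have hnew : ∀ u ∈ U, κ u = n →
        (if u ∈ U₀ then f₀ u else φ u (Function.update l n c (κ u))) = φ u c := by
      intro u hu hun
      simp [hdisj u hu, hun]
    have hcases : ∀ u ∈ U₀ ∪ U.filter (fun x => κ x < n + 1), u ∈ W ∨ u ∈ U ∧ κ u = n := by
      intro u hu
      rw [mem_union, mem_filter] at hu
      rw [hW, mem_union, mem_filter]
      rcases hu with hu | ⟨hu, hun⟩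
      · tauto
      · rcases Nat.lt_succ_iff_lt_or_eq.1 hun with h | h <;> tauto
    intro u hu v hv huv
    rcases hcases u hu with hu | ⟨hu, hun⟩ <;> rcases hcases v hv with hv | ⟨hv, hvn⟩
    · rw [hold u hu, hold v hv]
      exact hl u hu v hv huv
    · rw [hold u hu, hnew v hv hvn]
      exact hc' u hu v hv huv
    · rw [hnew u hu hun, hold v hv, H.adj_comm]
      exact hc' v hv u hu huv.symm
    · exact absurd (hun.trans hvn.symm) (hκ u hu v hv huv)

/-- The vertices of `U` are colored with classes that correspond to colors of one vertex `a₀`, then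
`B` is colored greedily, and then the vertices with long lists. -/
theorem hasColoring_of_labels (h : IsMatchedPair H L M) {a₀ : A} (ha₀ : a₀ ∈ B)
    (U U₀ : Finset V) (hdisj : ∀ u ∈ U, u ∉ U₀) (κ : V → ℕ) (P : Finset ℕ)
    (hκP : ∀ u ∈ U, κ u ∈ P) (hκ : ∀ u ∈ U, ∀ v ∈ U, G.Adj u v → κ u ≠ κ v)
    (f₀ : V → C) (hf₀ : ∀ u ∈ U₀, f₀ u ∈ L u)
    (hff₀ : ∀ u ∈ U₀, ∀ v ∈ U₀, G.Adj u v → ¬ H.Adj (f₀ u) (f₀ v))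
    (hfull : ∀ u ∈ U, ∀ c ∈ M a₀, ∃ c' ∈ L u, H.Adj c c')
    (htri : ∀ u ∈ U, ∀ a ∈ B, a ≠ a₀ → ∀ c ∈ M a₀, ∀ c' ∈ M a, ∀ d ∈ L u,
      H.Adj c d → H.Adj c' d → H.Adj c c')
    (hdeg : ∑ v, G.degree v < #(M a₀)) (e : A → ℕ)
    (he : ∀ a ∈ B, #((M a).filter fun c => ∃ u ∈ U₀, H.Adj c (f₀ u)) ≤ e a)
    (hB : ∀ a ∈ B, #P + e a + #B ≤ #(M a) + 1) (hB₀ : #P + e a₀ + #B ≤ #(M a₀))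
    (hS : ∀ v, v ∉ U → v ∉ U₀ → #B + G.degree v + 1 ≤ #(L v)) : HasColoring G H L M B := by
  have hC : Nonempty C := ⟨(card_pos.1 (Nat.zero_lt_of_lt hdeg)).choose⟩
  choose! φ hφ hφadj using hfull
  obtain ⟨l, hlX, hl⟩ := exists_labels (G := G) h.LL (M a₀) φ U U₀ hdisj κ hφ
    (fun u hu c₁ h₁ c₂ h₂ hh => h.LM u a₀ (φ u c₁) (hφ u hu c₁ h₁) c₁ h₁ c₂ h₂
      (hφadj u hu c₁ h₁).symm (hh ▸ (hφadj u hu c₂ h₂).symm)) hκ f₀ hf₀ hff₀ hdeg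
  set f : V → C := fun u => if u ∈ U₀ then f₀ u else φ u (l (κ u)) with hf
  have hfL : ∀ u ∈ U₀ ∪ U, f u ∈ L u := by
    intro u hu
    by_cases h0 : u ∈ U₀
    · simpa [hf, h0] using hf₀ u h0
    · have hu' : u ∈ U := by
        rw [mem_union] at hu
        tauto
      simpa [hf, h0] using hφ u hu' _ (hlX _)
  set M' : A → Finset C := fun a => (M a).filter fun c => ∀ u ∈ U₀ ∪ U, ¬ H.Adj c (f u) with hM'
  have hM'M : ∀ a, M' a ⊆ M a := fun a => filter_subset _ _
  have hkill : ∀ a ∈ B, #(M a) ≤ #(M' a) + (#P + e a) := by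
    intro a ha
    -- `K p` contains all that class `p` takes from `M a`, however many vertices the class has: by
    -- `htri` a color of `M a` in conflict with the class is adjacent to the label `l p`, or equal
    -- to it if `a = a₀`.
    set K : ℕ → Finset C := fun p =>
      (M a).filter fun c => if a = a₀ then c = l p else H.Adj (l p) c with hK
    have hK1 : ∀ p ∈ P, #(K p) ≤ 1 := by
      intro p _
      rw [card_le_one]
      intro c₁ h₁ c₂ h₂
      rw [hK, mem_filter] at h₁ h₂
      by_cases hh : a = a₀
      · rw [if_pos hh] at h₁ h₂
        exact h₁.2.trans h₂.2.symm
      · rw [if_neg hh] at h₁ h₂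
        exact h.MM a₀ a (l p) (hlX p) c₁ h₁.1 c₂ h₂.1 h₁.2 h₂.2
    have hsub : M a ⊆ M' a ∪ (P.biUnion K ∪ (M a).filter fun c => ∃ u ∈ U₀, H.Adj c (f₀ u)) := by
      intro c hc
      simp only [mem_union, mem_biUnion, hM', mem_filter, hc, true_and]
      by_contra! hcon
      obtain ⟨⟨u, hu, hcu⟩, hcK, hc0⟩ := hcon
      by_cases h0 : u ∈ U₀
      · simp only [hf, h0, if_true] at hcu
        exact hc0 u h0 hcu
      · have hu' : u ∈ U := by tauto
        simp only [hf, h0, if_false] at hcu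
        refine hcK (κ u) (hκP u hu') ?_
        rw [hK, mem_filter]
        refine ⟨hc, ?_⟩
        have hlu := hφadj u hu' _ (hlX (κ u))
        have hlm := hφ u hu' _ (hlX (κ u))
        by_cases hh : a = a₀
        · rw [if_pos hh]
          subst hh
          exact h.LM u a _ hlm c hc _ (hlX _) hcu.symm hlu.symm
        · rw [if_neg hh]
          exact htri u hu' a ha hh _ (hlX _) c hc _ hlm hlu hcu
    have h1 := card_le_card hsub
    have h2 := card_union_le (M' a) (P.biUnion K ∪ (M a).filter fun c => ∃ u ∈ U₀, H.Adj c (f₀ u))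
    have h3 := card_union_le (P.biUnion K) ((M a).filter fun c => ∃ u ∈ U₀, H.Adj c (f₀ u))
    have h4 := card_biUnion_le_card_mul P K 1 hK1
    have h5 := he a ha
    omega
  -- The remaining lists may have only `#B - 1` colors; the full list at `a₀` makes up for this.
  obtain ⟨g, hg, hgg⟩ := exists_coloring_clique_of_last (H := H) (M := M')
    (fun a b => (h.MM a b).mono (hM'M a) (hM'M b)) ha₀
    (fun a ha => by have := hkill a ha; have := hB a ha; omega)
    (by have := hkill a₀ ha₀; omega)
  refine hasColoring_of_extend h (U₀ ∪ U) f g hfL (fun a ha => hM'M a (hg a ha)) hl ?_ hgg ?_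
  · intro a ha v hv
    have := hg a ha
    rw [hM', mem_filter] at this
    exact this.2 v hv
  · intro v hv
    rw [mem_union, not_or] at hv
    exact hS v hv.2 hv.1

/-! ### Induction on the shortfall -/

/-- If some list `L v` is longer than required, then there is a coloring. The induction is on the
total number of colors that the lists `L v` lack for a greedy coloring. -/
theorem hasColoring_of_gain
    (hκ : ∀ v, ∃ κ : V → ℕ, (∀ x y, G.Adj x y → κ x ≠ κ y) ∧ κ v = r ∧ ∀ x, x ≠ v → κ x < r)
    (d : ℕ) : ∀ (L : V → Finset C) (M : A → Finset C) (B : Finset A), IsAmple H L M B r →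
      (∃ v, #B + r + 1 ≤ #(L v)) → ∑ v, (#B + G.degree v + 1 - #(L v)) ≤ d →
      (d = 0 ∨ 2 * d + ∑ v, G.degree v + 1 ≤ #B) → HasColoring G H L M B := by
  induction d with
  | zero =>
    -- With no shortfall, all of `G` can be colored greedily after `B`, so no bound on `#B` is
    -- needed.
    rintro L M B h ⟨v₀, hv₀⟩ hd -
    have hC : Nonempty C := ⟨(card_pos.1 (by omega : 0 < #(L v₀))).choose⟩
    obtain ⟨g, hg, hgg⟩ := exists_coloring_clique h.matched.MM B fun a ha => by
      have := h.card_M a ha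
      omega
    refine hasColoring_of_extend h.matched ∅ (fun _ => hC.some) g (by simp) hg (by simp) (by simp)
      hgg fun v _ => ?_
    have := (single_le_sum (f := fun v => #B + G.degree v + 1 - #(L v)) (fun _ _ => Nat.zero_le _)
      (mem_univ v)).trans hd
    omega
  | succ d ih =>
    rintro L M B h ⟨v₀, hv₀⟩ hd hdB
    -- A unit of shortfall may cost two vertices of `B`, hence the factor 2; the rest keeps `M a₀`
    -- larger than the degree sum, as the choice of labels requires.
    replace hdB : 2 * (d + 1) + ∑ v, G.degree v + 1 ≤ #B := hdB.resolve_left (Nat.succ_ne_zero d)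
    have hmono : ∀ {L' : V → Finset C} {M' : A → Finset C} {B' : Finset A}, IsAmple H L' M' B' r →
        ∀ {a : A} {c : C}, a ∈ B' → c ∈ M' a → ∀ v,
        #(B'.erase a) + G.degree v + 1 - #(avoid H c (L' v)) ≤ #B' + G.degree v + 1 - #(L' v) := by
      intro L' M' B' h' a c ha hc v
      have h1 := (h'.matched.ML a v).card_le_card_avoid_add_one hc
      have h2 := card_erase_add_one ha
      omega
    have hv₀mono : ∀ {L' : V → Finset C} {M' : A → Finset C} {B' : Finset A},
        IsAmple H L' M' B' r → #B' + r + 1 ≤ #(L' v₀) → ∀ {a : A} {c : C}, a ∈ B' → c ∈ M' a →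
        #(B'.erase a) + r + 1 ≤ #(avoid H c (L' v₀)) := by
      intro L' M' B' h' h0 a c ha hc
      have h1 := (h'.matched.ML a v₀).card_le_card_avoid_add_one hc
      have h2 := card_erase_add_one ha
      omega
    -- If `c` has no neighbor in the list of a short vertex, coloring `a` with `c` reduces the
    -- shortfall there and increases it nowhere.
    have hgain : ∀ {L' : V → Finset C} {M' : A → Finset C} {B' : Finset A}, IsAmple H L' M' B' r →
        #B' + r + 1 ≤ #(L' v₀) → ∑ v, (#B' + G.degree v + 1 - #(L' v)) ≤ d + 1 →
        #B ≤ #B' + 1 → ∀ {a : A} {c : C} {v : V}, a ∈ B' → c ∈ M' a →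
        #(L' v) < #B' + G.degree v + 1 → (∀ c' ∈ L' v, ¬ H.Adj c c') →
        HasColoring G H L' M' B' := by
      intro L' M' B' h' h0 hd' hBB a c v ha hc hv hcv
      have h2 := card_erase_add_one ha
      refine HasColoring.of_avoid hc (ih _ _ _ (h'.avoid ha hc) ⟨v₀, hv₀mono h' h0 ha hc⟩ ?_
        (Or.inr (by omega)))
      refine Nat.lt_succ_iff.1 (lt_of_lt_of_le (sum_lt_sum (fun v _ => hmono h' ha hc v)
        ⟨v, mem_univ v, ?_⟩) hd')
      rw [avoid_eq_self hcv]
      omega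
    by_cases h1 : ∃ v, #(L v) < #B + G.degree v + 1 ∧ ∃ a ∈ B, ∃ c ∈ M a, ∀ c' ∈ L v, ¬ H.Adj c c'
    · obtain ⟨v, hv, a, ha, c, hc, hcv⟩ := h1
      exact hgain h hv₀ hd (Nat.le_succ _) ha hc hv hcv
    -- Using both `c` and `c'` costs `v` only their common neighbor `w`. After `c` is used, either
    -- `v` is no longer short, or `c'` has no neighbor left in its list and `hgain` applies.
    by_cases h2 : ∃ v, #(L v) < #B + G.degree v + 1 ∧ ∃ a ∈ B, ∃ b ∈ B, b ≠ a ∧ ∃ c ∈ M a,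
        ∃ c' ∈ M b, ∃ w ∈ L v, H.Adj c w ∧ H.Adj c' w ∧ ¬ H.Adj c c'
    · obtain ⟨v, hv, a, ha, b, hb, hba, c, hc, c', hc', w, hw, hcw, hc'w, hcc'⟩ := h2
      have e1 := card_erase_add_one ha
      refine HasColoring.of_avoid hc ?_
      by_cases hv' : #(avoid H c (L v)) < #(B.erase a) + G.degree v + 1
      · refine hgain (h.avoid ha hc) (hv₀mono h hv₀ ha hc)
          ((sum_le_sum fun v _ => hmono h ha hc v).trans hd) (by omega)
          (mem_erase.2 ⟨hba, hb⟩) (mem_avoid.2 ⟨hc', hcc'⟩) hv' fun w' hw' hcw' => ?_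
        rw [mem_avoid] at hw'
        exact hw'.2 (h.matched.ML b v c' hc' w hw w' hw'.1 hc'w hcw' ▸ hcw)
      · refine ih _ _ _ (h.avoid ha hc) ⟨v₀, hv₀mono h hv₀ ha hc⟩ ?_ (Or.inr (by omega))
        refine Nat.lt_succ_iff.1 (lt_of_lt_of_le (sum_lt_sum (fun v _ => hmono h ha hc v)
          ⟨v, mem_univ v, ?_⟩) hd)
        omega
    push Not at h1 h2
    -- From here on the colors of any clique vertex are consistent labels at all short vertices.
    obtain ⟨a₀, ha₀⟩ := card_pos.1 (by omega : 0 < #B)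
    have hM₀ := h.card_M a₀ ha₀
    by_cases hS : ∃ v₁, #B + G.degree v₁ + 1 ≤ #(L v₁)
    · obtain ⟨v₁, hv₁⟩ := hS
      obtain ⟨κ, hκ1, -, hκ3⟩ := hκ v₁
      have hU : ∀ u, u ∈ univ.filter (fun v => #(L v) < #B + G.degree v + 1) ↔
          #(L u) < #B + G.degree u + 1 := by simp
      refine hasColoring_of_labels h.matched ha₀
        (univ.filter fun v => #(L v) < #B + G.degree v + 1) ∅ (by simp) κ (range r) ?_
        (fun u _ v _ => hκ1 u v) (fun v => (card_pos.1 (by omega : 0 < #(M a₀))).choose)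
        (by simp) (by simp) ?_ ?_ (by omega) (fun _ => 0) (by simp) ?_ ?_ ?_
      · intro u hu
        rw [hU] at hu
        exact mem_range.2 (hκ3 u (by rintro rfl; omega))
      · intro u hu c hc
        exact h1 u ((hU u).1 hu) a₀ ha₀ c hc
      · intro u hu a ha hne c hc c' hc' w hw
        exact h2 u ((hU u).1 hu) a₀ ha₀ a ha hne c hc c' hc' w hw
      · intro a ha
        have := h.card_M a ha
        rw [card_range]
        omega
      · rw [card_range]
        omega
      · intro v hv _
        rw [hU] at hv
        omega
    push Not at hS
    obtain ⟨κ, hκ1, hκ2, hκ3⟩ := hκ v₀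
    -- All vertices are short, so `r + 1` classes are labeled. The lists of `B` may then be one
    -- color too small, but the extra color of `M a₀` allows `a₀` to come last.
    by_cases hM : #B + r + 1 ≤ #(M a₀)
    · refine hasColoring_of_labels h.matched ha₀ univ ∅ (by simp) κ (range (r + 1)) ?_
        (fun u _ v _ => hκ1 u v) (fun v => (card_pos.1 (by omega : 0 < #(M a₀))).choose)
        (by simp) (by simp) (fun u _ c hc => h1 u (hS u) a₀ ha₀ c hc)
        (fun u _ a ha hne c hc c' hc' w hw => h2 u (hS u) a₀ ha₀ a ha hne c hc c' hc' w hw)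
        (by omega) (fun _ => 0) (by simp) ?_ ?_ (by simp)
      · intro u _
        rw [mem_range]
        by_cases hu : u = v₀
        · subst hu; omega
        · have := hκ3 u hu; omega
      · intro a ha
        have := h.card_M a ha
        rw [card_range]
        omega
      · rw [card_range]
        omega
    -- Now `L v₀` is larger than `M a₀`, so some `w` in it has no label. The class `{v₀}` takes `w`,
    -- which costs `a₀` nothing and every other vertex of `B` at most one color.
    · obtain ⟨w, hw, hwM⟩ := exists_mem_forall_not (M a₀) (L v₀) H.Adj
        (h.matched.ML a₀ v₀) (by omega)
      refine hasColoring_of_labels h.matched ha₀ {v₀}ᶜ {v₀} (by simp) κ (range r) ?_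
        (fun u _ v _ => hκ1 u v) (fun _ => w) (by simpa using hw) (by simp)
        (fun u _ c hc => h1 u (hS u) a₀ ha₀ c hc)
        (fun u _ a ha hne c hc c' hc' w hw => h2 u (hS u) a₀ ha₀ a ha hne c hc c' hc' w hw)
        (by omega) (fun a => if a = a₀ then 0 else 1) ?_ ?_ ?_ ?_
      · intro u hu
        exact mem_range.2 (hκ3 u (by simpa using hu))
      · intro a ha
        simp only [mem_singleton, exists_eq_left]
        by_cases hh : a = a₀
        · subst hh
          simpa [filter_eq_empty_iff] using hwM
        · rw [if_neg hh, card_le_one]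
          intro c₁ hc₁ c₂ hc₂
          rw [mem_filter] at hc₁ hc₂
          exact h.matched.LM v₀ a w hw c₁ hc₁.1 c₂ hc₂.1 hc₁.2.symm hc₂.2.symm
      · intro a ha
        have := h.card_M a ha
        simp only [card_range]
        split_ifs <;> omega
      · simp only [card_range, if_true]
        omega
      · intro v hv hv'
        simp at hv hv'
        exact absurd hv hv'

end Core

end DPColoring

namespace DPColoring

/-! ### Rigidity of lists without a coloring -/

section Rigid

open Finset

open scoped Classical

variable {V : Type u} {A : Type v} {C : Type w} {G : SimpleGraph V} {H : SimpleGraph C}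
  {L : V → Finset C} {M : A → Finset C} {B : Finset A} {r : ℕ} [Fintype V]

/-- If the colors of `a₀` are consistent labels for all colors but some label is not consistent
along an edge `uv` of `G`, then there is a coloring. -/
theorem hasColoring_of_twisted_edge (h : IsAmple H L M B r) {a₀ : A} (ha₀ : a₀ ∈ B) {u v : V}
    (hκ : ∃ κ : V → ℕ, (∀ x, κ x < r) ∧ κ u = κ v ∧
      ∀ x y, G.Adj x y → s(x, y) ≠ s(u, v) → κ x ≠ κ y)
    (hfull : ∀ v, ∀ c ∈ M a₀, ∃ c' ∈ L v, H.Adj c c')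
    (htri : ∀ v, ∀ a ∈ B, a ≠ a₀ → ∀ c ∈ M a₀, ∀ c' ∈ M a, ∀ d ∈ L v,
      H.Adj c d → H.Adj c' d → H.Adj c c')
    (hdeg : ∑ v, G.degree v < #(M a₀)) {c w w' : C} (hc : c ∈ M a₀) (hw : w ∈ L u)
    (hw' : w' ∈ L v) (hcw : H.Adj c w) (hcw' : H.Adj c w') (hww' : ¬ H.Adj w w') :
    HasColoring G H L M B := by
  obtain ⟨κ, hκr, hκuv, hκ⟩ := hκ
  choose φ hφ hφadj using fun v => hfull v c hc
  have hφu : φ u = w := h.matched.ML a₀ u c hc _ (hφ u) _ hw (hφadj u) hcw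
  have hφv : φ v = w' := h.matched.ML a₀ v c hc _ (hφ v) _ hw' (hφadj v) hcw'
  have hP : #((range r).erase (κ u)) + 1 = r := by
    rw [card_erase_add_one (mem_range.2 (hκr u)), card_range]
  -- The class of `u` and `v` is fixed in advance with label `c`; its only edge is `uv`, where `w`
  -- and `w'` do not conflict. It takes at most one color from each `M a` and the other `r - 1`
  -- classes one each, so `#B` colors remain.
  refine hasColoring_of_labels h.matched ha₀ (univ.filter fun x => κ x ≠ κ u)
    (univ.filter fun x => κ x = κ u) (by simp) κ ((range r).erase (κ u)) ?_ ?_ φ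
    (fun x _ => hφ x) ?_ (fun x _ => hfull x) (fun x _ => htri x) hdeg (fun _ => 1) ?_ ?_ ?_ ?_
  · intro x hx
    exact mem_erase.2 ⟨(mem_filter.1 hx).2, mem_range.2 (hκr x)⟩
  · intro x hx y _ hxy
    refine hκ x y hxy fun e => ?_
    rw [mem_filter] at hx
    rcases Sym2.eq_iff.1 e with ⟨rfl, rfl⟩ | ⟨rfl, rfl⟩
    · exact hx.2 rfl
    · exact hx.2 hκuv.symm
  · intro x hx y hy hxy
    rw [mem_filter] at hx hy
    by_cases e : s(x, y) = s(u, v)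
    · rcases Sym2.eq_iff.1 e with ⟨rfl, rfl⟩ | ⟨rfl, rfl⟩
      · rwa [hφu, hφv]
      · rwa [hφu, hφv, H.adj_comm]
    · exact absurd (hx.2.trans hy.2.symm) (hκ x y hxy e)
  · intro a ha
    rw [card_le_one]
    intro c₁ hc₁ c₂ hc₂
    rw [mem_filter] at hc₁ hc₂
    obtain ⟨hm₁, x, -, hx⟩ := hc₁
    obtain ⟨hm₂, y, -, hy⟩ := hc₂
    by_cases haa : a = a₀
    · subst haa
      rw [h.matched.LM x a _ (hφ x) _ hm₁ _ hc hx.symm (hφadj x).symm,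
        h.matched.LM y a _ (hφ y) _ hm₂ _ hc hy.symm (hφadj y).symm]
    · exact h.matched.MM a₀ a c hc c₁ hm₁ c₂ hm₂
        (htri x a ha haa c hc c₁ hm₁ _ (hφ x) (hφadj x) hx)
        (htri y a ha haa c hc c₂ hm₂ _ (hφ y) (hφadj y) hy)
  · intro a ha
    have := h.card_M a ha
    omega
  · have := h.card_M a₀ ha₀
    omega
  · intro x hx hx'
    simp at hx hx'
    exact absurd hx hx'

/-- Lists without a coloring are matched perfectly and consistently. -/
theorem consistent_of_not_hasColoring [Fintype A]
    (hκ : ∀ v, ∃ κ : V → ℕ, (∀ x y, G.Adj x y → κ x ≠ κ y) ∧ κ v = r ∧ ∀ x, x ≠ v → κ x < r)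
    (hκ' : ∀ u v, G.Adj u v → ∃ κ : V → ℕ, (∀ x, κ x < r) ∧ κ u = κ v ∧
      ∀ x y, G.Adj x y → s(x, y) ≠ s(u, v) → κ x ≠ κ y)
    (hbig : (1 ≤ r ∧ 3 * ∑ v, G.degree v + 3 ≤ Fintype.card A) ∨ Subsingleton V)
    (h : IsAmple H L M univ r) (hno : ¬ HasColoring G H L M univ) :
    (∀ a v, ∀ c ∈ M a, ∃ c' ∈ L v, H.Adj c c') ∧
    (∀ v a b, a ≠ b → ∀ c ∈ M a, ∀ c' ∈ M b, ∀ d ∈ L v,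
      H.Adj c d → H.Adj c' d → H.Adj c c') ∧
    ∀ u v, G.Adj u v → ∀ a, ∀ c ∈ M a, ∀ d ∈ L u, ∀ d' ∈ L v,
      H.Adj c d → H.Adj c d' → H.Adj d d' := by
  have hgain : ∀ {L' : V → Finset C} {M' : A → Finset C} {B' : Finset A}, IsAmple H L' M' B' r →
      (∃ v, #B' + r + 1 ≤ #(L' v)) → Fintype.card A ≤ #B' + 2 → HasColoring G H L' M' B' := by
    intro L' M' B' h' hv hB'
    rcases hbig with ⟨hr, hA⟩ | hV
    -- Since `1 ≤ r`, the shortfall at `v` is at most its degree. At most two clique vertices have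
    -- been used, which accounts for the constant 3 in `hbig`.
    · refine hasColoring_of_gain hκ (∑ v, G.degree v) L' M' B' h' hv (sum_le_sum fun v _ => ?_)
        (Or.inr (by omega))
      have := h'.card_L v
      omega
    · refine hasColoring_of_gain hκ 0 L' M' B' h' hv ?_ (Or.inl rfl)
      obtain ⟨v, hv⟩ := hv
      rw [Nat.le_zero, sum_eq_zero_iff]
      intro x _
      have hx : G.degree x = 0 := by
        rw [SimpleGraph.degree_eq_zero_iff_notMem_support, SimpleGraph.mem_support]
        rintro ⟨y, hy⟩
        exact hy.ne (Subsingleton.elim x y)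
      rw [Subsingleton.elim v x] at hv
      omega
  have hfull : ∀ a v, ∀ c ∈ M a, ∃ c' ∈ L v, H.Adj c c' := by
    intro a v c hc
    by_contra! hcon
    have h1 := card_erase_add_one (mem_univ a)
    have h2 := h.card_L v
    rw [card_univ] at h1 h2
    -- Coloring `a` with `c` leaves `L v` intact while the clique shrinks: this is a gain at `v`.
    refine hno (HasColoring.of_avoid hc (hgain (h.avoid (mem_univ a) hc) ⟨v, ?_⟩ (by omega)))
    rw [avoid_eq_self hcon]
    omega
  have htri : ∀ v a b, a ≠ b → ∀ c ∈ M a, ∀ c' ∈ M b, ∀ d ∈ L v,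
      H.Adj c d → H.Adj c' d → H.Adj c c' := by
    intro v a b hab c hc c' hc' d hd hcd hc'd
    by_contra hcc'
    have hb : b ∈ univ.erase a := mem_erase.2 ⟨hab.symm, mem_univ b⟩
    have hc'' : c' ∈ avoid H c (M b) := mem_avoid.2 ⟨hc', hcc'⟩
    have h1 := card_erase_add_one (mem_univ a)
    have h2 := card_erase_add_one hb
    have h3 := h.card_L v
    have h4 := (h.matched.ML a v).card_le_card_avoid_add_one hc
    rw [card_univ] at h1 h3
    -- Coloring `a` and `b` with `c` and `c'` removes only `d` from `L v`, again a gain.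
    refine hno (HasColoring.of_avoid hc (HasColoring.of_avoid hc''
      (hgain ((h.avoid (mem_univ a) hc).avoid hb hc'') ⟨v, ?_⟩ (by omega))))
    rw [avoid_eq_self (c := c')]
    · omega
    · intro w hw hcw
      rw [mem_avoid] at hw
      exact hw.2 (h.matched.ML b v c' hc' d hd w hw.1 hc'd hcw ▸ hcd)
  refine ⟨hfull, htri, ?_⟩
  intro u v huv a c hc d hd d' hd' hcd hcd'
  by_contra hdd'
  rcases hbig with ⟨-, hA⟩ | hV
  · refine hno (hasColoring_of_twisted_edge h (mem_univ a) (hκ' u v huv) (hfull a)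
      (fun x b _ hba => htri x a b hba.symm) ?_ hc hd hd' hcd hcd' hdd')
    have := h.card_M a (mem_univ a)
    rw [card_univ] at this
    omega
  · exact huv.ne (Subsingleton.elim u v)

end Rigid

/-! ### Colorings of critical graphs and criticality of the join -/

section Critical

variable {V : Type u} {G : SimpleGraph V} {r t : ℕ}

theorem IsKCritical.exists_nat_coloring (h : IsKCritical G (r + 1)) {G' : G.Subgraph}
    (hG' : G' ≠ ⊤) :
    ∃ κ : V → ℕ, (∀ x ∈ G'.verts, κ x < r) ∧ ∀ x y, G'.Adj x y → κ x ≠ κ y := by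
  classical
  have h1 := h.2 G' hG'
  push_cast at h1
  rw [ENat.lt_add_one_iff (ENat.natCast_ne_top r), SimpleGraph.chromaticNumber_le_iff_colorable] at h1
  obtain ⟨f⟩ := h1
  refine ⟨fun x => if hx : x ∈ G'.verts then f ⟨x, hx⟩ else 0, ?_, ?_⟩
  · intro x hx
    simp [hx]
  · intro x y hxy
    have hx := G'.edge_vert hxy
    have hy := G'.edge_vert hxy.symm
    simp only [hx, hy, dif_pos]
    intro e
    exact f.valid (v := ⟨x, hx⟩) (w := ⟨y, hy⟩) hxy (Fin.ext e)

/-- A critical graph has a coloring in which a given vertex forms a class. -/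
theorem IsKCritical.exists_coloring_vertex (h : IsKCritical G (r + 1)) (v : V) :
    ∃ κ : V → ℕ, (∀ x y, G.Adj x y → κ x ≠ κ y) ∧ κ v = r ∧ ∀ x, x ≠ v → κ x < r := by
  classical
  obtain ⟨κ, h1, h2⟩ := h.exists_nat_coloring (G' := (⊤ : G.Subgraph).deleteVerts {v}) (by
    intro e
    have : v ∈ ((⊤ : G.Subgraph).deleteVerts {v}).verts := by rw [e]; trivial
    simp at this)
  simp only [SimpleGraph.Subgraph.deleteVerts_verts, SimpleGraph.Subgraph.verts_top, Set.mem_sdiff,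
    Set.mem_univ, Set.mem_singleton_iff, true_and] at h1
  have h3 : ∀ x, x ≠ v → Function.update κ v r x < r := by
    intro x hx
    simpa [hx] using h1 x hx
  refine ⟨Function.update κ v r, ?_, by simp, h3⟩
  intro x y hxy
  by_cases hx : x = v
  · subst hx
    simpa using (h3 y hxy.ne').ne'
  · by_cases hy : y = v
    · subst hy
      simpa using (h3 x hx).ne
    · simpa [hx, hy] using h2 x y (by simp [hx, hy, hxy])

/-- A critical graph without an edge has a coloring in which the ends of the edge have the same
color. -/
theorem IsKCritical.exists_coloring_edge (h : IsKCritical G (r + 1)) (u v : V) (huv : G.Adj u v) :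
    ∃ κ : V → ℕ, (∀ x, κ x < r) ∧ κ u = κ v ∧
      ∀ x y, G.Adj x y → s(x, y) ≠ s(u, v) → κ x ≠ κ y := by
  obtain ⟨κ, h1, h2⟩ := h.exists_nat_coloring (G' := (⊤ : G.Subgraph).deleteEdges {s(u, v)}) (by
    intro e
    have : ((⊤ : G.Subgraph).deleteEdges {s(u, v)}).Adj u v := by rw [e]; exact huv
    simp at this)
  have h2' : ∀ x y, G.Adj x y → s(x, y) ≠ s(u, v) → κ x ≠ κ y := fun x y hxy hne =>
    h2 x y (by simpa [hxy] using hne)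
  have h1' : ∀ x, κ x < r := fun x => h1 x (by simp)
  refine ⟨κ, h1', ?_, h2'⟩
  by_contra hne
  have hcol : G.Colorable r := ⟨SimpleGraph.Coloring.mk (fun x => (⟨κ x, h1' x⟩ : Fin r)) (by
    intro x y hxy e
    have e' : κ x = κ y := congrArg Fin.val e
    by_cases hs : s(x, y) = s(u, v)
    · rcases Sym2.eq_iff.1 hs with ⟨rfl, rfl⟩ | ⟨rfl, rfl⟩
      · exact hne e'
      · exact hne e'.symm
    · exact h2' x y hxy hs e')⟩
  have h3 := hcol.chromaticNumber_le
  rw [h.1] at h3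
  exact absurd (Nat.cast_le.1 h3) (Nat.not_succ_le_self r)

@[simp]
theorem join_adj_inl_inl {W : Type v} {K : SimpleGraph W} {x y : V} :
    (join G K).Adj (Sum.inl x) (Sum.inl y) ↔ G.Adj x y := by
  simp [join]

@[simp]
theorem join_adj_inr_inr {W : Type v} {K : SimpleGraph W} {x y : W} :
    (join G K).Adj (Sum.inr x) (Sum.inr y) ↔ K.Adj x y := by
  simp [join]

@[simp]
theorem join_adj_inl_inr {W : Type v} {K : SimpleGraph W} {x : V} {y : W} :
    (join G K).Adj (Sum.inl x) (Sum.inr y) := by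
  simp [join]

@[simp]
theorem join_adj_inr_inl {W : Type v} {K : SimpleGraph W} {x : V} {y : W} :
    (join G K).Adj (Sum.inr y) (Sum.inl x) := by
  simp [join]

/-- The clique uses `t` distinct colors, none of which can occur on `G`. -/
theorem colorable_of_colorable_join {n : ℕ}
    (h : (join G (SimpleGraph.completeGraph (Fin t))).Colorable (n + t)) : G.Colorable n := by
  classical
  obtain ⟨f⟩ := h
  set S : Finset (Fin (n + t)) := (Finset.univ.image fun i : Fin t => f (Sum.inr i))ᶜ with hS
  have hcard : Fintype.card S = n := by
    rw [Fintype.card_coe, hS, Finset.card_compl, Finset.card_image_of_injective]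
    · simp
    · intro i j hij
      by_contra hne
      exact f.valid (v := Sum.inr i) (w := Sum.inr j) (by simpa using hne) hij
  have hmem : ∀ x : V, f (Sum.inl x) ∈ S := by
    intro x
    simp only [hS, Finset.mem_compl, Finset.mem_image, Finset.mem_univ, true_and, not_exists]
    exact fun i => f.valid (v := Sum.inr i) (w := Sum.inl x) (by simp)
  rw [← hcard]
  refine (SimpleGraph.Coloring.mk (fun x => (⟨f (Sum.inl x), hmem x⟩ : S)) ?_).colorable
  intro x y hxy e
  exact f.valid (v := Sum.inl x) (w := Sum.inl y) (by simpa using hxy) (congrArg Subtype.val e)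

/-- A proper subgraph misses a vertex or an edge. In each case a coloring of `G` that is critical in
the matching place combines with `t` clique colors to save one color. -/
theorem IsKCritical.join_completeGraph [Nonempty V] (h : IsKCritical G (r + 1)) (t : ℕ) :
    IsKCritical (join G (SimpleGraph.completeGraph (Fin t))) (r + t + 1) := by
  constructor
  · apply le_antisymm
    · rw [SimpleGraph.chromaticNumber_le_iff_colorable]
      obtain ⟨κ, h1, h2, h3⟩ := h.exists_coloring_vertex (Classical.arbitrary V)
      have hκ : ∀ x, κ x < r + 1 := by
        intro x
        by_cases hx : x = Classical.arbitrary V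
        · rw [hx, h2]; omega
        · exact (h3 x hx).trans (Nat.lt_succ_self r)
      refine ⟨SimpleGraph.Coloring.mk (fun x => (⟨Sum.elim κ (fun i : Fin t => r + 1 + (i : ℕ)) x, ?_⟩ :
        Fin (r + t + 1))) ?_⟩
      · rcases x with x | i
        · have := hκ x
          simp only [Sum.elim_inl]
          omega
        · have := i.2
          simp only [Sum.elim_inr]
          omega
      · rintro (x | i) (y | j) hxy e
        all_goals simp only [Fin.mk.injEq, Sum.elim_inl, Sum.elim_inr] at e
        · exact h1 x y (by simpa using hxy) e
        · have := hκ x; omega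
        · have := hκ y; omega
        · have : i ≠ j := by simpa using hxy
          exact this (Fin.ext (by omega))
    · by_contra hlt
      rw [not_le] at hlt
      push_cast at hlt
      rw [ENat.lt_add_one_iff (by exact_mod_cast ENat.natCast_ne_top (r + t))] at hlt
      have hcol : (join G (SimpleGraph.completeGraph (Fin t))).Colorable (r + t) :=
        SimpleGraph.chromaticNumber_le_iff_colorable.1 (by exact_mod_cast hlt)
      have h3 := (colorable_of_colorable_join hcol).chromaticNumber_le
      rw [h.1] at h3
      exact absurd (Nat.cast_le.1 h3) (Nat.not_succ_le_self r)
  · intro G' hG'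
    suffices hF : ∃ F : V ⊕ Fin t → ℕ, (∀ x ∈ G'.verts, F x < r + t) ∧
        ∀ x y, G'.Adj x y → F x ≠ F y by
      obtain ⟨F, h1, h2⟩ := hF
      have hcol : G'.coe.Colorable (r + t) :=
        ⟨SimpleGraph.Coloring.mk (fun x => (⟨F x, h1 x x.2⟩ : Fin (r + t)))
          fun {x y} hxy e => h2 x y hxy (congrArg Fin.val e)⟩
      exact lt_of_le_of_lt hcol.chromaticNumber_le (Nat.cast_lt.2 (Nat.lt_succ_self _))
    have hcross : ∀ (v : V) (i : Fin t), ¬ G'.Adj (Sum.inl v) (Sum.inr i) →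
        ∃ F : V ⊕ Fin t → ℕ, (∀ x ∈ G'.verts, F x < r + t) ∧
          ∀ x y, G'.Adj x y → F x ≠ F y := by
      classical
      intro v i hvi
      obtain ⟨κ, h1, h2, h3⟩ := h.exists_coloring_vertex v
      -- The missing edge lets `v`, alone in its class, share the color of `i`.
      refine ⟨Sum.elim (fun x => if x = v then r + i else κ x) (fun j => r + j), ?_, ?_⟩
      · rintro (x | j) -
        · by_cases hx : x = v
          · simp [hx]
          · have := h3 x hx
            simp only [Sum.elim_inl, hx, if_false]
            omega
        · simp
      · rintro (x | j) (y | k) hxy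
        · have hadj : G.Adj x y := by simpa using hxy.adj_sub
          have hne := hadj.ne
          have h4 := h1 x y hadj
          have h5 := h3 x
          have h6 := h3 y
          simp only [Sum.elim_inl]
          split_ifs with hx hy hy
          · exact absurd (hx.trans hy.symm) hne
          · have := h6 hy; omega
          · have := h5 hx; omega
          · exact h4
        · have h5 := h3 x
          simp only [Sum.elim_inl, Sum.elim_inr]
          split_ifs with hx
          · rintro e
            have : i = k := Fin.ext (by omega)
            subst hx this
            exact hvi hxy
          · have := h5 hx; omega
        · have h5 := h3 y
          simp only [Sum.elim_inl, Sum.elim_inr]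
          split_ifs with hx
          · rintro e
            have : i = j := Fin.ext (by omega)
            subst hx this
            exact hvi hxy.symm
          · have := h5 hx; omega
        · have hne : j ≠ k := by simpa using hxy.adj_sub
          simp only [Sum.elim_inr]
          exact fun e => hne (Fin.ext (by omega))
    have hcases : (∃ x, x ∉ G'.verts) ∨ ∃ x y,
        (join G (SimpleGraph.completeGraph (Fin t))).Adj x y ∧ ¬ G'.Adj x y := by
      by_contra! hcon
      refine hG' (SimpleGraph.Subgraph.ext ?_ ?_)
      · exact Set.eq_univ_of_forall hcon.1
      · ext x y
        exact ⟨fun hxy => hxy.adj_sub, fun hxy => hcon.2 x y hxy⟩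
    rcases hcases with ⟨x | i, hx⟩ | ⟨x | i, y | j, hxy, hne⟩
    · obtain ⟨κ, h1, h2, h3⟩ := h.exists_coloring_vertex x
      have hy : ∀ y, Sum.inl y ∈ G'.verts → κ y < r := fun y hy => h3 y (by rintro rfl; exact hx hy)
      refine ⟨Sum.elim κ (fun j => r + j), ?_, ?_⟩
      · rintro (y | j) hj
        · have := hy y hj
          simp only [Sum.elim_inl]
          omega
        · simp
      · rintro (y | j) (z | k) hyz
        · exact h1 y z (by simpa using hyz.adj_sub)
        · have := hy y (G'.edge_vert hyz)
          simp only [Sum.elim_inl, Sum.elim_inr]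
          omega
        · have := hy z (G'.edge_vert hyz.symm)
          simp only [Sum.elim_inl, Sum.elim_inr]
          omega
        · have hne : j ≠ k := by simpa using hyz.adj_sub
          simp only [Sum.elim_inr]
          exact fun e => hne (Fin.ext (by omega))
    · exact hcross (Classical.arbitrary V) i fun hadj => hx (G'.edge_vert hadj.symm)
    · obtain ⟨κ, h1, h2, h3⟩ := h.exists_coloring_edge x y (by simpa using hxy)
      refine ⟨Sum.elim κ (fun j => r + j), ?_, ?_⟩
      · rintro (z | j) -
        · have := h1 z
          simp only [Sum.elim_inl]
          omega
        · simp
      · rintro (z | j) (z' | k) hz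
        · refine h3 z z' (by simpa using hz.adj_sub) fun e => ?_
          rcases Sym2.eq_iff.1 e with ⟨rfl, rfl⟩ | ⟨rfl, rfl⟩
          · exact hne hz
          · exact hne hz.symm
        · have := h1 z
          simp only [Sum.elim_inl, Sum.elim_inr]
          omega
        · have := h1 z'
          simp only [Sum.elim_inl, Sum.elim_inr]
          omega
        · have hne : j ≠ k := by simpa using hz.adj_sub
          simp only [Sum.elim_inr]
          exact fun e => hne (Fin.ext (by omega))
    · exact hcross x j hne
    · exact hcross y i fun hadj => hne hadj.symm
    · classical
      obtain ⟨κ, h1, h2, h3⟩ := h.exists_coloring_vertex (Classical.arbitrary V)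
      have hij : i ≠ j := by simpa using hxy
      have hκ : ∀ x, κ x ≤ r := by
        intro x
        by_cases hx : x = Classical.arbitrary V
        · rw [hx, h2]
        · exact (h3 x hx).le
      -- As `ij` is missing, `i` can share the color of `j`; this frees the color `r + i` for the
      -- one vertex of `G` in class `r`.
      refine ⟨Sum.elim (fun x => if κ x = r then r + i else κ x)
        (fun k => if k = i then r + j else r + k), ?_, ?_⟩
      · rintro (z | k) -
        · have := hκ z
          have := i.2
          simp only [Sum.elim_inl]
          split_ifs <;> omega
        · simp only [Sum.elim_inr]
          split_ifs <;> simp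
      · have hmix : ∀ z k, (if κ z = r then r + (i : ℕ) else κ z) ≠
            if k = i then r + (j : ℕ) else r + k := by
          intro z k
          have := hκ z
          have hij' : (i : ℕ) ≠ j := fun e => hij (Fin.ext e)
          split_ifs with ha hb hb
          · omega
          · have : (k : ℕ) ≠ i := fun e => hb (Fin.ext e)
            omega
          · omega
          · omega
        rintro (z | k) (z' | k') hz
        · have h4 := h1 z z' (by simpa using hz.adj_sub)
          have := hκ z
          have := hκ z'
          simp only [Sum.elim_inl]
          split_ifs <;> omega
        · exact hmix z k'
        · exact (hmix z' k).symm
        · have hkk : k ≠ k' := by simpa using hz.adj_sub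
          simp only [Sum.elim_inr]
          split_ifs with ha hb hb
          · exact absurd (ha.trans hb.symm) hkk
          · intro e
            have : j = k' := Fin.ext (by omega)
            subst ha this
            exact hne hz
          · intro e
            have : j = k := Fin.ext (by omega)
            subst hb this
            exact hne hz.symm
          · exact fun e => hkk (Fin.ext (by omega))

end Critical

end DPColoring

namespace DPColoring

/-! ### From consistent labels to canonical covers -/

section Covers

variable {V : Type u} {G : SimpleGraph V} {C : Type w} {k : ℕ}

/-- A cover is canonical if its colors can be labeled by the colors of one vertex such that, along
each edge, colors with the same label are adjacent. -/
theorem Cover.isCanonical_of_labels {𝓗 : Cover G C} (hk : 𝓗.IsFold k) (x₀ : V) (e : C → C)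
    (hmaps : ∀ x, Set.MapsTo e (𝓗.L x) (𝓗.L x₀)) (hinj : ∀ x, Set.InjOn e (𝓗.L x))
    (hadj : ∀ x y, G.Adj x y → ∀ c ∈ 𝓗.L x, ∀ c' ∈ 𝓗.L y, e c = e c' → 𝓗.H.Adj c c') :
    𝓗.IsCanonical k := by
  have hfin : ∀ x, (𝓗.L x).Finite := fun x => Set.finite_of_encard_eq_coe (hk x)
  have hsurj : ∀ x, Set.SurjOn e (𝓗.L x) (𝓗.L x₀) := by
    intro x
    have h1 : (e '' 𝓗.L x) ⊆ 𝓗.L x₀ := (hmaps x).image_subset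
    have h2 : (e '' 𝓗.L x) = 𝓗.L x₀ := by
      refine (hfin x₀).eq_of_subset_of_encard_le' h1 ?_
      rw [(hinj x).encard_image, hk x, hk x₀]
    exact h2.ge
  have hcard : Nat.card (𝓗.L x₀) = k := by
    have := hk x₀
    rw [← (hfin x₀).cast_ncard_eq] at this
    exact_mod_cast this
  have : Finite (𝓗.L x₀) := hfin x₀
  let E : 𝓗.L x₀ ≃ Fin k := Finite.equivFinOfCardEq hcard
  have hx : ∀ c : C, ∃ x, c ∈ 𝓗.L x := fun c =>
    Set.mem_iUnion.1 (𝓗.covers.symm ▸ Set.mem_univ c)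
  have hmem : ∀ c : C, e c ∈ 𝓗.L x₀ := fun c => hmaps _ (hx c).choose_spec
  refine ⟨hk, fun c => E ⟨e c, hmem c⟩, fun x => ⟨fun _ _ => Set.mem_univ _, ?_, ?_⟩, ?_⟩
  · intro c hc c' hc' h
    exact hinj x hc hc' (congrArg Subtype.val (E.injective h))
  · intro i _
    obtain ⟨c, hc, hci⟩ := hsurj x (E.symm i).2
    refine ⟨c, hc, ?_⟩
    have : (⟨e c, hmem c⟩ : 𝓗.L x₀) = E.symm i := Subtype.ext hci
    simp only [this, Equiv.apply_symm_apply]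
  · intro x y hxy c hc c' hc'
    simp only [E.injective.eq_iff, Subtype.mk.injEq]
    refine ⟨fun h => ?_, hadj x y hxy c hc c' hc'⟩
    -- The neighbor of `c` in the list of `y` is unique, and the color there with the label of `c`
    -- is one.
    obtain ⟨c'', hc'', he⟩ := hsurj y (hmem c)
    rw [𝓗.matching x y c hc c' hc' c'' hc'' h (hadj x y hxy c hc c'' hc'' he.symm), he]

/-- A coloring from the lists of a cover of the join of `G` and `K_t` is an independent
transversal. -/
theorem not_isBad_of_hasColoring {t : ℕ}
    {𝓗 : Cover (join G (SimpleGraph.completeGraph (Fin t))) C} {L : V → Finset C}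
    {M : Fin t → Finset C} (hL : ∀ v c, c ∈ L v ↔ c ∈ 𝓗.L (Sum.inl v))
    (hM : ∀ a c, c ∈ M a ↔ c ∈ 𝓗.L (Sum.inr a))
    (h : HasColoring G 𝓗.H L M Finset.univ) : ¬ 𝓗.IsBad := by
  obtain ⟨f, g, hf, hg, hff, hgf, hgg⟩ := h
  have hF : ∀ x, Sum.elim f g x ∈ 𝓗.L x := by
    rintro (v | a)
    · exact (hL v _).1 (hf v)
    · exact (hM a _).1 (hg a (Finset.mem_univ a))
  refine not_not.2 ⟨Set.range (Sum.elim f g), ?_, ?_⟩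
  · rintro _ ⟨x, rfl⟩ _ ⟨y, rfl⟩ hne hadj
    have hxy := 𝓗.adj_of_adj x y _ (hF x) _ (hF y) hadj
    rcases x with u | a <;> rcases y with v | b
    · exact hff u v (by simpa using hxy) hadj
    · exact hgf b (Finset.mem_univ b) u hadj.symm
    · exact hgf a (Finset.mem_univ a) v hadj
    · exact hgg a (Finset.mem_univ a) b (Finset.mem_univ b) (by simpa using hxy) hadj
  · intro x
    refine ⟨Sum.elim f g x, ⟨⟨x, rfl⟩, hF x⟩, ?_⟩
    rintro _ ⟨⟨y, rfl⟩, hy⟩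
    by_cases hxy : y = x
    · rw [hxy]
    · exact absurd hy (Set.disjoint_left.1 (𝓗.disjoint hxy) (hF y))

/-- Bad covers of the join of a critical graph and a large complete graph are canonical. -/
theorem IsKCritical.isCanonical_of_isBad [Fintype V] [Nonempty V] {r t : ℕ}
    (h : IsKCritical G (r + 1)) [DecidableRel G.Adj]
    (hbig : (1 ≤ r ∧ 3 * ∑ v, G.degree v + 3 ≤ t) ∨ (r = 0 ∧ Subsingleton V))
    (𝓗 : Cover (join G (SimpleGraph.completeGraph (Fin t))) C) (hfold : 𝓗.IsFold (r + t))
    (hbad : 𝓗.IsBad) : 𝓗.IsCanonical (r + t) := by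
  classical
  have hfin : ∀ x, (𝓗.L x).Finite := fun x => Set.finite_of_encard_eq_coe (hfold x)
  set Λ : V ⊕ Fin t → Finset C := fun x => (hfin x).toFinset with hΛ
  have hmem : ∀ x c, c ∈ Λ x ↔ c ∈ 𝓗.L x := fun x c => (hfin x).mem_toFinset
  have hcard : ∀ x, (Λ x).card = r + t := by
    intro x
    have := hfold x
    rw [(hfin x).encard_eq_coe_toFinset_card] at this
    exact_mod_cast this
  have hmatch : ∀ x y, Matched 𝓗.H (Λ x) (Λ y) := fun x y c hc c₁ h₁ c₂ h₂ =>
    𝓗.matching x y c ((hmem x c).1 hc) c₁ ((hmem y c₁).1 h₁) c₂ ((hmem y c₂).1 h₂)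
  have hample : IsAmple 𝓗.H (fun v => Λ (Sum.inl v)) (fun a => Λ (Sum.inr a)) Finset.univ r :=
    { matched := ⟨fun _ _ => hmatch _ _, fun _ _ => hmatch _ _, fun _ _ => hmatch _ _,
        fun _ _ => hmatch _ _⟩
      card_M := fun a _ => by rw [hcard, Finset.card_univ, Fintype.card_fin, add_comm]
      card_L := fun v => by rw [hcard, Finset.card_univ, Fintype.card_fin, add_comm] }
  obtain ⟨hfull, htri, hedge⟩ := consistent_of_not_hasColoring h.exists_coloring_vertex
    h.exists_coloring_edge
    (by
      rcases hbig with ⟨h1, h2⟩ | ⟨-, h2⟩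
      · left
        rw [Fintype.card_fin]
        convert And.intro h1 h2
      · exact Or.inr h2) hample
    fun hcol => not_isBad_of_hasColoring (fun _ _ => hmem _ _) (fun _ _ => hmem _ _) hcol hbad
  have hx : ∀ c : C, ∃ x, c ∈ 𝓗.L x := fun c =>
    Set.mem_iUnion.1 (𝓗.covers.symm ▸ Set.mem_univ c)
  rcases Nat.eq_zero_or_pos t with rfl | ht
  -- Without clique vertices there is no `a₀` to supply labels, but then `hbig` forces `r = 0` and
  -- there are no colors at all.
  · have hr : r = 0 := by omega
    subst hr
    have hC : IsEmpty C := ⟨fun c => by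
      obtain ⟨x, hc⟩ := hx c
      have := hcard x
      rw [Finset.card_eq_zero] at this
      rw [← hmem, this] at hc
      exact absurd hc (Finset.notMem_empty c)⟩
    obtain ⟨v⟩ := ‹Nonempty V›
    exact Cover.isCanonical_of_labels hfold (Sum.inl v) id (fun x c => isEmptyElim c)
      (fun x c => isEmptyElim c) (fun x y _ c => isEmptyElim c)
  set a₀ : Fin t := ⟨0, ht⟩ with ha₀
  -- every color of a vertex of `G` has a neighbor in each list of a vertex of `K_t`
  have hback : ∀ v a, ∀ d ∈ Λ (Sum.inl v), ∃ c ∈ Λ (Sum.inr a), 𝓗.H.Adj c d := by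
    intro v a d hd
    choose φ hφ hφadj using hfull a v
    -- The matching is injective from the list of `a` to that of `v`; both have `r + t` colors, so
    -- it is also onto.
    obtain ⟨c, hc, hcd⟩ := Finset.surj_on_of_inj_on_of_card_le φ hφ
      (fun c₁ c₂ h₁ h₂ e => hmatch (Sum.inl v) (Sum.inr a) _ (hφ c₁ h₁) _ h₁ _ h₂
        (hφadj c₁ h₁).symm (e ▸ (hφadj c₂ h₂).symm)) (by rw [hcard, hcard]) d hd
    exact ⟨c, hc, hcd ▸ hφadj c hc⟩
  have hlab : ∀ x, x ≠ Sum.inr a₀ → ∀ c ∈ Λ x, ∃ e ∈ Λ (Sum.inr a₀), 𝓗.H.Adj e c := by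
    rintro (v | b) hne c hc
    · exact hback v a₀ c hc
    -- Consistency between clique vertices is known only for colors with a common neighbor at a
    -- vertex of `G`, so the label is found through such a vertex.
    · obtain ⟨v⟩ := ‹Nonempty V›
      obtain ⟨d, hd, hcd⟩ := hfull b v c hc
      obtain ⟨e, he, hed⟩ := hback v a₀ d hd
      exact ⟨e, he, htri v a₀ b (by rintro rfl; exact hne rfl) e he c hc d hd hed hcd⟩
  have hlab' : ∀ c : C, ∃ e ∈ Λ (Sum.inr a₀), (c ∈ Λ (Sum.inr a₀) ∧ e = c) ∨
      (c ∉ Λ (Sum.inr a₀) ∧ 𝓗.H.Adj e c) := by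
    intro c
    by_cases hc : c ∈ Λ (Sum.inr a₀)
    · exact ⟨c, hc, Or.inl ⟨hc, rfl⟩⟩
    · obtain ⟨x, hcx⟩ := hx c
      rw [← hmem] at hcx
      obtain ⟨e, he, hec⟩ := hlab x (by rintro rfl; exact hc hcx) c hcx
      exact ⟨e, he, Or.inr ⟨hc, hec⟩⟩
  choose e he hecases using hlab'
  have he₀ : ∀ c ∈ Λ (Sum.inr a₀), e c = c := fun c hc =>
    (hecases c).elim (fun hh => hh.2) fun hh => absurd hc hh.1
  have he₁ : ∀ x, x ≠ Sum.inr a₀ → ∀ c ∈ Λ x, 𝓗.H.Adj (e c) c := by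
    intro x hne c hc
    refine (hecases c).elim (fun hh => ?_) fun hh => hh.2
    exact absurd ((hmem _ c).1 hh.1) (Set.disjoint_left.1 (𝓗.disjoint hne) ((hmem x c).1 hc))
  -- two colors of `v` and `b ≠ a₀` with the same label are adjacent
  have hvb : ∀ v b, b ≠ a₀ → ∀ c ∈ Λ (Sum.inr a₀), ∀ d ∈ Λ (Sum.inl v), ∀ c' ∈ Λ (Sum.inr b),
      𝓗.H.Adj c d → 𝓗.H.Adj c c' → 𝓗.H.Adj c' d := by
    intro v b hb c hc d hd c' hc' hcd hcc'
    obtain ⟨b', hb', hbd⟩ := hback v b d hd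
    rwa [hmatch _ _ c hc c' hc' b' hb' hcc' (htri v a₀ b hb.symm c hc b' hb' d hd hcd hbd)]
  refine Cover.isCanonical_of_labels hfold (Sum.inr a₀) e (fun x c _ => (hmem _ _).1 (he c)) ?_ ?_
  · intro x c hc c' hc' hee
    rw [← hmem] at hc hc'
    by_cases hxa : x = Sum.inr a₀
    · subst hxa
      rwa [he₀ c hc, he₀ c' hc'] at hee
    · exact hmatch _ x (e c) (he c) c hc c' hc' (he₁ x hxa c hc) (hee ▸ he₁ x hxa c' hc')
  · intro x y hxy c hc c' hc' hee
    rw [← hmem] at hc hc'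
    by_cases hxa : x = Sum.inr a₀
    · subst hxa
      have := he₁ y hxy.ne' c' hc'
      rwa [← hee, he₀ c hc] at this
    by_cases hya : y = Sum.inr a₀
    · subst hya
      have := he₁ x hxa c hc
      rw [hee, he₀ c' hc'] at this
      exact this.symm
    have h1 := he₁ x hxa c hc
    have h2 := he₁ y hya c' hc'
    rw [← hee] at h2
    rcases x with u | a <;> rcases y with v | b
    · exact hedge u v (by simpa using hxy) a₀ (e c) (he c) c hc c' hc' h1 h2
    · exact (hvb u b (by rintro rfl; exact hya rfl) (e c) (he c) c hc c' hc' h1 h2).symm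
    · exact hvb v a (by rintro rfl; exact hxa rfl) (e c) (he c) c' hc' c hc h2 h1
    · obtain ⟨v⟩ := ‹Nonempty V›
      obtain ⟨d, hd, hed⟩ := hfull a₀ v (e c) (he c)
      exact htri v a b (by simpa using hxy) c hc c' hc' d hd
        (hvb v a (by rintro rfl; exact hxa rfl) (e c) (he c) d hd c hc hed h1)
        (hvb v b (by rintro rfl; exact hya rfl) (e c) (he c) d hd c' hc' hed h2)

end Covers

end DPColoring

/-! ### Conclusion -/

theorem mainTheorem1 {V : Type u} [Finite V] [Nonempty V] (G : SimpleGraph V)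
    (hG : DPColoring.IsCritical G) (m : ℕ) (hm : G.edgeSet.ncard = m)
    (t : ℕ) (ht : 100 * m ^ 3 ≤ t) :
    DPColoring.IsRobustlyCritical.{u, w} (DPColoring.join G (SimpleGraph.completeGraph (Fin t))) := by
  classical
  have := Fintype.ofFinite V
  obtain ⟨k, hk⟩ := hG
  obtain ⟨r, rfl⟩ : ∃ r, k = r + 1 := by
    refine Nat.exists_eq_succ_of_ne_zero ?_
    rintro rfl
    have h0 : G.Colorable 0 := SimpleGraph.chromaticNumber_le_iff_colorable.1 hk.1.le
    exact (h0.some (Classical.arbitrary V)).elim0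
  have hsum : ∑ v, G.degree v = 2 * m := by
    rw [G.sum_degrees_eq_twice_card_edges, ← hm, Set.ncard_eq_toFinset_card',
      SimpleGraph.edgeFinset]
  refine ⟨r + t + 1, by omega, hk.join_completeGraph t, fun C 𝓗 hfold hbad =>
    hk.isCanonical_of_isBad ?_ 𝓗 hfold hbad⟩
  rcases Nat.eq_zero_or_pos m with rfl | hpos
  -- An edgeless critical graph is a single vertex. It is treated apart because `t` may then be
  -- arbitrarily small.
  · right
    have hbot : G = ⊥ := by
      rw [← SimpleGraph.edgeSet_eq_empty]
      exact (Set.ncard_eq_zero (Set.toFinite _)).1 hm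
    have hr : r = 0 := by
      have hcol : G.Colorable 1 := ⟨SimpleGraph.Coloring.mk (fun _ => (0 : Fin 1)) (by
        intro x y hxy
        rw [hbot] at hxy
        exact absurd hxy (by simp))⟩
      have := hcol.chromaticNumber_le
      rw [hk.1] at this
      have := Nat.cast_le.1 this
      omega
    subst hr
    refine ⟨rfl, ⟨fun x y => ?_⟩⟩
    by_contra hne
    obtain ⟨κ, -, -, h3⟩ := hk.exists_coloring_vertex y
    exact Nat.not_lt_zero _ (h3 x hne)
  · left
    constructor
    · obtain ⟨s, hs⟩ := (Set.ncard_pos (Set.toFinite _)).1 (hm ▸ hpos)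
      induction s with
      | _ x y =>
        obtain ⟨κ, -, -, h3⟩ := hk.exists_coloring_vertex y
        exact Nat.one_le_of_lt (h3 x (SimpleGraph.Adj.ne hs))
    -- The degree sum is `2 * m`, so the requirement is `6 * m + 3 ≤ t`, which is far below the
    -- cubic bound.
    · have : m ≤ m ^ 3 := Nat.le_self_pow (by norm_num) m
      omega
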